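/- **Cake cutting lower bound.** The cake is the interval $[0,1]$. Each of $n$ agents $i$ has a valuation $V_i(S)=\int_S v_i(x)\,dx$ with a non-negative integrable density $v_i$ on $[0,1]$ and $V_i([0,1])=1$. A contiguous allocation is a partition of $[0,1]$ into $n$ intervals $A_1,\dots,A_n$, agent $i$ receiving $A_i$; it is proportional if $V_i(A_i)\ge 1/n$ for all $i$. In the Robertson–Webb model an algorithm accesses the valuations through queries $\mathrm{Cut}_i(\alpha)$ with $\alpha\in[0,1]$, answered by the leftmost $y$ with $V_i([0,y])=\alpha$ (which then becomes a cut point), and $\mathrm{Eval}_i(y)$, answered by $V_i([0,y])$, where $y$ is a cut point made in an earlier round or $y\in\{0,1\}$. A $k$-round (randomized) algorithm issues in each of $k$ rounds a finite, possibly empty, batch of queries that may depend on its random seed and on the answers of earlier rounds only, and finally outputs a contiguous allocation whose pieces have all their endpoints among $0$, $1$ and the cut points made during the execution. For every $p>0$ and every $C>0$ there is a constant $c>0$, depending only on $p$ and $C$, such that for all integers $n\ge 2$ and $1\le k\le C\log_2 n$ the following holds. Every $k$-round randomized algorithm that, on every instance $(V_1,\dots,V_n)$, outputs a proportional contiguous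 allocation with probability at least $p$ issues at least $c\,k\,n^{1+1/k}$ queries in expectation on some instance. -/

import Mathlib

open MeasureTheory

namespace CakeCutting

noncomputable section

/-- A normalized valuation of the cake `[0,1]`, given by its value density. -/
structure Valuation where
  density : ℝ → ℝ
  density_nonneg : ∀ x ∈ Set.Icc (0 : ℝ) 1, 0 ≤ density x
  integrableOn : IntegrableOn density (Set.Icc 0 1)
  total : ∫ x in Set.Icc (0 : ℝ) 1, density x = 1

/-- The value of a part `S` of the cake. -/
def Valuation.value (v : Valuation) (S : Set ℝ) : ℝ := ∫ x in S, v.density x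

/-- The answer to `Cut(α)`: the leftmost point `y` of the cake with `v [0,y] = α`. -/
def Valuation.cut (v : Valuation) (α : ℝ) : ℝ :=
  sInf {y : ℝ | y ∈ Set.Icc (0 : ℝ) 1 ∧ v.value (Set.Icc 0 y) = α}

/-- The answer to `Eval(y)`: the value of `[0,y]`. -/
def Valuation.eval (v : Valuation) (y : ℝ) : ℝ := v.value (Set.Icc 0 y)

/-- A cake cutting instance: one valuation for each of the `n` agents. -/
abbrev Profile (n : ℕ) : Type := Fin n → Valuation

/-- A partition of `[0,1]` into `n` intervals, `piece i` going to agent `i`. -/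
structure ContiguousAllocation (n : ℕ) where
  piece : Fin n → Set ℝ
  ordConnected : ∀ i, (piece i).OrdConnected
  disjoint : ∀ i j, i ≠ j → Disjoint (piece i) (piece j)
  iUnion_eq : ⋃ i, piece i = Set.Icc (0 : ℝ) 1

/-- Every agent gets at least a `1/n` share by her own valuation. -/
def ContiguousAllocation.Proportional {n : ℕ} (A : ContiguousAllocation n) (V : Profile n) :
    Prop :=
  ∀ i, 1 / (n : ℝ) ≤ (V i).value (A.piece i)

/-- All endpoints of the pieces belong to `C`. -/
def ContiguousAllocation.DemarcatedBy {n : ℕ} (A : ContiguousAllocation n) (C : Set ℝ) : Prop :=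
  ∀ i, frontier (A.piece i) ⊆ C

/-- Robertson-Webb queries to `n` agents. -/
inductive Query (n : ℕ) : Type
  | cut (i : Fin n) (α : ℝ) : Query n
  | eval (i : Fin n) (y : ℝ) : Query n

/-- The answer of the queried agent. -/
def Query.answer {n : ℕ} (V : Profile n) : Query n → ℝ
  | .cut i α => (V i).cut α
  | .eval i y => (V i).eval y

/-- A query is admissible, `C` being the set of cut points made in earlier rounds, if it is a cut
query with argument in `[0,1]` or an evaluation query at a point of `C`. -/
def Query.Admissible {n : ℕ} (C : Set ℝ) : Query n → Prop
  | .cut _ α => α ∈ Set.Icc (0 : ℝ) 1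
  | .eval _ y => y ∈ C

/-- The cut points that a list of queries makes on the instance `V`. -/
def cutPoints {n : ℕ} (V : Profile n) (qs : List (Query n)) : Set ℝ :=
  {x | ∃ i α, Query.cut i α ∈ qs ∧ x = (V i).cut α}

/-- Deterministic `k`-round protocols for `n` agents, as decision trees: each of the `k` rounds
issues a finite (possibly empty) list of queries at once, and the continuation depends on the list
of answers; after the last round an allocation is output. -/
inductive Protocol (n : ℕ) : ℕ → Type
  | done (A : ContiguousAllocation n) : Protocol n 0
  | round {k : ℕ} (qs : List (Query n)) (next : List ℝ → Protocol n k) : Protocol n (k + 1)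

namespace Protocol

/-- The allocation output on the instance `V`. -/
def output {n : ℕ} (V : Profile n) : {k : ℕ} → Protocol n k → ContiguousAllocation n
  | _, done A => A
  | _, round qs next => output V (next (qs.map (Query.answer V)))

/-- The total number of queries issued on the instance `V`. -/
def numQueries {n : ℕ} (V : Profile n) : {k : ℕ} → Protocol n k → ℕ
  | _, done _ => 0
  | _, round qs next => qs.length + numQueries V (next (qs.map (Query.answer V)))

/-- The execution on the instance `V` obeys the rules of the Robertson-Webb model, `C` being the set
of cut points already available: all queries are admissible with respect to the cut points of
earlier rounds, and the output is demarcated by cut points of the execution. -/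
def Legal {n : ℕ} (V : Profile n) : {k : ℕ} → Protocol n k → Set ℝ → Prop
  | _, done A, C => A.DemarcatedBy C
  | _, round qs next, C =>
      (∀ q ∈ qs, q.Admissible C) ∧
        Legal V (next (qs.map (Query.answer V))) (C ∪ cutPoints V qs)

end Protocol

/-- A randomized `k`-round Robertson-Webb algorithm for `n` agents, with random seed in `Ω`: for each
seed a deterministic protocol that obeys the rules on every instance. The endpoints `0` and `1` of
the cake are available from the start. -/
structure RandomizedAlgorithm (n k : ℕ) (Ω : Type*) [MeasurableSpace Ω] where
  protocol : Ω → Protocol n k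
  legal : ∀ (ω : Ω) (V : Profile n), (protocol ω).Legal V {0, 1}
  measurable_numQueries : ∀ V : Profile n, Measurable fun ω => (protocol ω).numQueries V
  measurableSet_proportional : ∀ V : Profile n,
    MeasurableSet {ω | ((protocol ω).output V).Proportional V}

/-- The probability that the algorithm outputs a proportional allocation on the instance `V`. -/
def RandomizedAlgorithm.successProb {n k : ℕ} {Ω : Type*} [MeasurableSpace Ω]
    (𝒜 : RandomizedAlgorithm n k Ω) (μ : Measure Ω) (V : Profile n) : ENNReal :=
  μ {ω | ((𝒜.protocol ω).output V).Proportional V}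

/-- The expected number of queries issued on the instance `V`. -/
def RandomizedAlgorithm.expectedQueries {n k : ℕ} {Ω : Type*} [MeasurableSpace Ω]
    (𝒜 : RandomizedAlgorithm n k Ω) (μ : Measure Ω) (V : Profile n) : ENNReal :=
  ∫⁻ ω, ((𝒜.protocol ω).numQueries V : ENNReal) ∂μ

end

end CakeCutting

/-! The hard instances give the agents distinct ranks by a permutation. The cake has `n + 1` equal
regions of three slots; an agent of rank `r` puts value `1/(n+1)` into one slot of each region `J`:
left if `r < J`, middle if `r = J`, right if `r > J`. A share `1/n` exceeds the worth of one region,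
which pins the `j`-th boundary inside region `j+1` and forces the pieces to lie in rank order. So an
allocation is proportional for at most one permutation (`Proportional.perm_eq`).

A query learns only one slot of one agent, and slots are monotone in rank, so a batch with `mᵢ`
queries to agent `i` has at most `∏ (2 mᵢ + 1)` answer lists. Since later batches depend on earlier
answers, the count over the rounds is a Kraft sum with a free parameter `t`
(`Protocol.sum_exp_neg_numQueries_le`): within `k n (t - 1) / 2` queries at most `t ^ (k n)`
permutations are solved.

Averaging over permutations and seeds (`exists_le_expectedQueries`) and taking `t = (b n)^(1/k)`,
with `t ^ (k n)` below `p/2 · n!`, gives the bound for large `n`. For the remaining `n` it suffices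
that a success costs at least one query. -/

namespace CakeCutting

/-! ### The hard valuations, indexed by rank -/

/-- The slot of region `J` in which an agent of rank `r` puts the value of that region. -/
def slot (J r : ℕ) : ℕ := min (r + 1 - J) 2

lemma slot_le_two (J r : ℕ) : slot J r ≤ 2 := min_le_right _ _

lemma slot_mono (J : ℕ) : Monotone (slot J) := fun r s h => by unfold slot; omega

/-- The left end of slot `t` of region `J`, there being `n + 1` regions with three slots each. -/
noncomputable def slotLeft (n J t : ℕ) : ℝ := (3 * J + t) / (3 * (n + 1))

lemma slotLeft_nonneg (n J t : ℕ) : 0 ≤ slotLeft n J t := by unfold slotLeft; positivity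

lemma slotLeft_succ (n J t : ℕ) : slotLeft n J (t + 1) = slotLeft n J t + 1 / (3 * (n + 1)) := by
  unfold slotLeft; push_cast; field_simp; ring

lemma slotLeft_le_slotLeft {n J J' t t' : ℕ} (h : 3 * J + t ≤ 3 * J' + t') :
    slotLeft n J t ≤ slotLeft n J' t' := by
  unfold slotLeft
  have : (3 * J + t : ℝ) ≤ 3 * J' + t' := by exact_mod_cast h
  gcongr ?_ / _

lemma lt_of_slotLeft_lt {n J J' t t' : ℕ} (h : slotLeft n J t < slotLeft n J' t') :
    3 * J + t < 3 * J' + t' := by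
  by_contra! h'
  exact absurd (slotLeft_le_slotLeft h') (not_le.2 h)

lemma slotLeft_zero (n J : ℕ) : slotLeft n J 0 = J / (n + 1) := by
  unfold slotLeft; push_cast; rw [add_zero]; field_simp

lemma slotLeft_three (n J : ℕ) : slotLeft n J 3 = (J + 1) / (n + 1) := by
  unfold slotLeft; push_cast; field_simp

/-- The value density of the agent of rank `r`. -/
noncomputable def rankDensity (n r : ℕ) (x : ℝ) : ℝ :=
  ∑ J ∈ Finset.range (n + 1),
    (Set.Ioc (slotLeft n J (slot J r)) (slotLeft n J (slot J r + 1))).indicator (fun _ => 3) x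

lemma rankDensity_nonneg (n r : ℕ) (x : ℝ) : 0 ≤ rankDensity n r x :=
  Finset.sum_nonneg fun _ _ => Set.indicator_nonneg (fun _ _ => by norm_num) _

lemma integrable_slot_indicator (n J t : ℕ) :
    Integrable ((Set.Ioc (slotLeft n J t) (slotLeft n J (t + 1))).indicator
      (fun _ => (3 : ℝ))) := by
  rw [integrable_indicator_iff measurableSet_Ioc]
  exact integrableOn_const (by simp)

lemma integrable_rankDensity (n r : ℕ) : Integrable (rankDensity n r) :=
  integrable_finsetSum _ fun _ _ => integrable_slot_indicator _ _ _

/-- The part of slot `t` of region `J` that lies to the left of `y`, by value. -/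
noncomputable def slotValue (n J t : ℕ) (y : ℝ) : ℝ :=
  3 * max (min y (slotLeft n J (t + 1)) - slotLeft n J t) 0

lemma slotValue_mono (n J t : ℕ) : Monotone (slotValue n J t) := fun x y h => by
  unfold slotValue; gcongr

lemma slotValue_of_le {n J t : ℕ} {y : ℝ} (h : y ≤ slotLeft n J t) : slotValue n J t y = 0 := by
  have : min y (slotLeft n J (t + 1)) - slotLeft n J t ≤ 0 := by
    have := min_le_left y (slotLeft n J (t + 1)); linarith
  simp [slotValue, this]

lemma slotValue_of_ge {n J t : ℕ} {y : ℝ} (h : slotLeft n J (t + 1) ≤ y) :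
    slotValue n J t y = 1 / (n + 1) := by
  unfold slotValue
  rw [min_eq_right h, slotLeft_succ, max_eq_left]
  · field_simp; ring
  · ring_nf; positivity

lemma setIntegral_rankDensity (n r : ℕ) (y : ℝ) :
    ∫ x in Set.Icc 0 y, rankDensity n r x =
      ∑ J ∈ Finset.range (n + 1), slotValue n J (slot J r) y := by
  unfold rankDensity
  rw [integral_finsetSum _ fun J _ => (integrable_slot_indicator n J _).integrableOn]
  refine Finset.sum_congr rfl fun J _ => ?_
  rw [setIntegral_indicator measurableSet_Ioc, setIntegral_const]
  have : Set.Icc 0 y ∩ Set.Ioc (slotLeft n J (slot J r)) (slotLeft n J (slot J r + 1)) =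
      Set.Ioc (slotLeft n J (slot J r)) (min y (slotLeft n J (slot J r + 1))) := by
    ext x
    have := slotLeft_nonneg n J (slot J r)
    simp only [Set.mem_inter_iff, Set.mem_Icc, Set.mem_Ioc, le_min_iff]
    constructor
    · rintro ⟨⟨h1, h2⟩, h3, h4⟩; exact ⟨h3, h2, h4⟩
    · rintro ⟨h1, h2, h3⟩; exact ⟨⟨by linarith, h2⟩, h1, h3⟩
  rw [this, Real.volume_real_Ioc, smul_eq_mul, slotValue, mul_comm]

lemma sum_slotValue_of_mem {n J : ℕ} (hJ : J ≤ n) (r : ℕ) {y : ℝ}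
    (h1 : slotLeft n J 0 ≤ y) (h2 : y ≤ slotLeft n J 3) :
    ∑ I ∈ Finset.range (n + 1), slotValue n I (slot I r) y =
      J / (n + 1) + slotValue n J (slot J r) y := by
  have hl : ∀ I < J, slotValue n I (slot I r) y = 1 / (n + 1) := fun I hI =>
    slotValue_of_ge ((slotLeft_le_slotLeft (by have := slot_le_two I r; omega)).trans h1)
  have hr : ∀ I, J < I → slotValue n I (slot I r) y = 0 := fun I hI =>
    slotValue_of_le (h2.trans (slotLeft_le_slotLeft (by omega)))
  have hs : Finset.range (J + 1) ⊆ Finset.range (n + 1) := by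
    intro x; simp only [Finset.mem_range]; omega
  rw [← Finset.sum_subset hs, Finset.sum_range_succ,
    Finset.sum_congr rfl fun I hI => hl I (Finset.mem_range.1 hI)]
  · simp [div_eq_mul_inv]
  · intro I _ h
    exact hr I (by simpa using h)

/-- The valuation of the agent of rank `r`. -/
noncomputable def rankValuation (n r : ℕ) : Valuation where
  density := rankDensity n r
  density_nonneg x _ := rankDensity_nonneg n r x
  integrableOn := (integrable_rankDensity n r).integrableOn
  total := by
    rw [setIntegral_rankDensity, sum_slotValue_of_mem le_rfl, slotValue_of_ge]
    · field_simp
    · refine (slotLeft_le_slotLeft (J' := n) (t' := 3) ?_).trans_eq ?_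
      · have := slot_le_two n r; omega
      · rw [slotLeft_three]; field_simp
    · rw [slotLeft_zero, div_le_one (by positivity)]; linarith
    · rw [slotLeft_three]; field_simp; rfl

/-! ### Answers to queries on the hard valuations -/

lemma eval_rankValuation (n r : ℕ) (y : ℝ) :
    (rankValuation n r).eval y = ∑ J ∈ Finset.range (n + 1), slotValue n J (slot J r) y :=
  setIntegral_rankDensity n r y

lemma eval_rankValuation_mono (n r : ℕ) : Monotone (rankValuation n r).eval := fun x y h => by
  simp only [eval_rankValuation]
  exact Finset.sum_le_sum fun J _ => slotValue_mono n J _ h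

lemma eval_rankValuation_of_mem {n J : ℕ} (hJ : J ≤ n) (r : ℕ) {y : ℝ}
    (h1 : slotLeft n J 0 ≤ y) (h2 : y ≤ slotLeft n J 3) :
    (rankValuation n r).eval y = J / (n + 1) + slotValue n J (slot J r) y := by
  rw [eval_rankValuation, sum_slotValue_of_mem hJ r h1 h2]

lemma eval_rankValuation_slotLeft {n J : ℕ} (hJ : J ≤ n) (r : ℕ) {t : ℕ} (ht : t ≤ slot J r) :
    (rankValuation n r).eval (slotLeft n J t) = J / (n + 1) := by
  have := slot_le_two J r
  rw [eval_rankValuation_of_mem hJ r (slotLeft_le_slotLeft (by omega))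
    (slotLeft_le_slotLeft (by omega)), slotValue_of_le (slotLeft_le_slotLeft (by omega)), add_zero]

lemma eval_rankValuation_slotLeft' {n J : ℕ} (hJ : J ≤ n) (r : ℕ) {t : ℕ} (ht : slot J r < t)
    (ht' : t ≤ 3) : (rankValuation n r).eval (slotLeft n J t) = (J + 1) / (n + 1) := by
  rw [eval_rankValuation_of_mem hJ r (slotLeft_le_slotLeft (by omega))
    (slotLeft_le_slotLeft (by omega)), slotValue_of_ge (slotLeft_le_slotLeft (by omega)), add_div]

lemma exists_region {n : ℕ} {y : ℝ} (h0 : 0 < y) (h1 : y ≤ 1) :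
    ∃ J ≤ n, slotLeft n J 0 < y ∧ y ≤ slotLeft n J 3 := by
  have hN : (0 : ℝ) < n + 1 := by positivity
  have hpos : 0 < ⌈y * (n + 1)⌉₊ := Nat.ceil_pos.2 (by positivity)
  have hle : ⌈y * (n + 1)⌉₊ ≤ n + 1 := Nat.ceil_le.2 (by push_cast; nlinarith)
  obtain ⟨J, hJ⟩ := Nat.exists_eq_succ_of_ne_zero hpos.ne'
  refine ⟨J, by omega, ?_, ?_⟩
  · rw [slotLeft_zero, div_lt_iff₀ hN]
    exact Nat.lt_ceil.1 (by omega)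
  · rw [slotLeft_three, le_div_iff₀ hN]
    have := Nat.le_ceil (y * ((n : ℝ) + 1))
    rw [hJ] at this; push_cast at this; exact this

lemma eval_rankValuation_of_nonpos {n r : ℕ} {y : ℝ} (h : y ≤ 0) :
    (rankValuation n r).eval y = 0 := by
  rw [eval_rankValuation]
  exact Finset.sum_eq_zero fun J _ => slotValue_of_le (h.trans (slotLeft_nonneg _ _ _))

lemma eval_rankValuation_of_one_le {n r : ℕ} {y : ℝ} (h : 1 ≤ y) :
    (rankValuation n r).eval y = 1 := by
  rw [eval_rankValuation, Finset.sum_congr rfl fun J hJ => slotValue_of_ge (n := n) ?_]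
  · simp; field_simp
  · have := slot_le_two J r
    have hJ := Finset.mem_range.1 hJ
    refine (slotLeft_le_slotLeft (J' := n) (t' := 3) (by omega)).trans (le_trans ?_ h)
    rw [slotLeft_three]; field_simp; rfl

/-- The lower bound on `α` is strict because the leftmost point of value `J/(n+1)` already lies in
the preceding region. -/
lemma cut_rankValuation {n J : ℕ} (hJ : J ≤ n) (r : ℕ) {α : ℝ}
    (h1 : (J : ℝ) / (n + 1) < α) (h2 : α ≤ (J + 1) / (n + 1)) :
    (rankValuation n r).cut α = slotLeft n J (slot J r) + (α - J / (n + 1)) / 3 := by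
  have h2t := slot_le_two J r
  set a := slotLeft n J (slot J r) with ha
  have hb := slotLeft_succ n J (slot J r)
  rw [← ha] at hb
  have e : ((J : ℝ) + 1) / (n + 1) = J / (n + 1) + 1 / (n + 1) := add_div _ _ _
  have e3 : (1 : ℝ) / (3 * (n + 1)) = 1 / (n + 1) / 3 := by field_simp
  have h0a : slotLeft n J 0 ≤ a := slotLeft_le_slotLeft (by omega)
  have hb3 : slotLeft n J (slot J r + 1) ≤ slotLeft n J 3 := slotLeft_le_slotLeft (by omega)
  have key : ∀ z, a ≤ z → z ≤ slotLeft n J (slot J r + 1) →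
      (rankValuation n r).eval z = J / (n + 1) + 3 * (z - a) := fun z hz hz' => by
    rw [eval_rankValuation_of_mem hJ r (h0a.trans hz) (hz'.trans hb3), slotValue, min_eq_left hz',
      max_eq_left (by linarith)]
  refine IsLeast.csInf_eq ⟨⟨⟨?_, ?_⟩, ?_⟩, ?_⟩
  · have := slotLeft_nonneg n J (slot J r); linarith
  · have : slotLeft n J 3 ≤ 1 := by
      rw [slotLeft_three, div_le_one (by positivity)]; gcongr
    linarith
  · refine (key _ (by linarith) (by linarith)).trans (by ring)
  · rintro y ⟨-, hy⟩
    by_contra! hlt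
    have hm : (rankValuation n r).eval y ≤ (rankValuation n r).eval (max y a) :=
      eval_rankValuation_mono n r (le_max_left _ _)
    rw [key (max y a) (le_max_right _ _) (max_le (by linarith) (by linarith))] at hm
    have hy' : (rankValuation n r).eval y = α := hy
    have : max y a < a + (α - J / (n + 1)) / 3 := max_lt hlt (by linarith)
    linarith

lemma cut_rankValuation_of_nonpos {n r r' : ℕ} {α : ℝ} (h : α ≤ 0) :
    (rankValuation n r).cut α = (rankValuation n r').cut α := by
  rcases h.lt_or_eq with h | rfl
  -- No point qualifies, so the answer is the default `sInf ∅`, the same for every rank.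
  · have : ∀ s, {y : ℝ | y ∈ Set.Icc (0 : ℝ) 1 ∧ (rankValuation n s).value (Set.Icc 0 y) = α} = ∅ :=
      fun s => Set.eq_empty_of_forall_notMem fun y hy => by
        have h' : (rankValuation n s).eval y = α := hy.2
        have := eval_rankValuation_mono n s hy.1.1
        rw [eval_rankValuation_of_nonpos le_rfl] at this
        linarith
    simp only [Valuation.cut, this]
  · have : ∀ s, (rankValuation n s).cut 0 = 0 := fun s =>
      IsLeast.csInf_eq ⟨⟨⟨le_rfl, zero_le_one⟩, eval_rankValuation_of_nonpos le_rfl⟩,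
        fun y hy => hy.1.1⟩
    rw [this, this]

lemma cut_rankValuation_of_one_lt {n r r' : ℕ} {α : ℝ} (h : 1 < α) :
    (rankValuation n r).cut α = (rankValuation n r').cut α := by
  have : ∀ s, {y : ℝ | y ∈ Set.Icc (0 : ℝ) 1 ∧ (rankValuation n s).value (Set.Icc 0 y) = α} = ∅ :=
    fun s => Set.eq_empty_of_forall_notMem fun y hy => by
      have h' : (rankValuation n s).eval y = α := hy.2
      have := eval_rankValuation_mono n s hy.1.2
      rw [eval_rankValuation_of_one_le le_rfl] at this
      linarith
  simp only [Valuation.cut, this]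

/-- The instance in which agent `i` has rank `π i`. -/
noncomputable def rankProfile {n : ℕ} (π : Equiv.Perm (Fin n)) : Profile n :=
  fun i => rankValuation n (π i)

/-- The agent to whom a query is directed. -/
def Query.agent {n : ℕ} : Query n → Fin n
  | .cut i _ => i
  | .eval i _ => i

/-- All ranks agree on the value to the left of a region, so only the slot inside that region can
matter. For arguments outside `(0,1]` the answer is independent of the rank and `0` is an arbitrary
witness. -/
lemma Query.exists_region {n : ℕ} (q : Query n) :
    ∃ J : ℕ, ∀ π π' : Equiv.Perm (Fin n), slot J (π q.agent) = slot J (π' q.agent) →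
      q.answer (rankProfile π) = q.answer (rankProfile π') := by
  cases q with
  | cut i α =>
    simp only [agent, answer, rankProfile]
    rcases le_or_gt α 0 with h0 | h0
    · exact ⟨0, fun _ _ _ => cut_rankValuation_of_nonpos h0⟩
    rcases lt_or_ge 1 α with h1 | h1
    · exact ⟨0, fun _ _ _ => cut_rankValuation_of_one_lt h1⟩
    -- Every region is worth its length, so the region containing the point `α` is also the one
    -- where the value reaches `α`.
    obtain ⟨J, hJ, h2, h3⟩ := CakeCutting.exists_region (n := n) h0 h1
    rw [slotLeft_zero] at h2
    rw [slotLeft_three] at h3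
    exact ⟨J, fun π π' h => by rw [cut_rankValuation hJ _ h2 h3, cut_rankValuation hJ _ h2 h3, h]⟩
  | eval i y =>
    simp only [agent, answer, rankProfile]
    rcases le_or_gt y 0 with h0 | h0
    · exact ⟨0, fun _ _ _ => by
        rw [eval_rankValuation_of_nonpos h0, eval_rankValuation_of_nonpos h0]⟩
    rcases lt_or_ge 1 y with h1 | h1
    · exact ⟨0, fun _ _ _ => by
        rw [eval_rankValuation_of_one_le h1.le, eval_rankValuation_of_one_le h1.le]⟩
    obtain ⟨J, hJ, h2, h3⟩ := CakeCutting.exists_region (n := n) h0 h1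
    exact ⟨J, fun π π' h => by
      rw [eval_rankValuation_of_mem hJ _ h2.le h3, eval_rankValuation_of_mem hJ _ h2.le h3, h]⟩

lemma value_rankValuation_mono {n r : ℕ} {S T : Set ℝ} (h : S ⊆ T) :
    (rankValuation n r).value S ≤ (rankValuation n r).value T :=
  setIntegral_mono_set (integrable_rankDensity n r).integrableOn
    (ae_of_all _ fun x => rankDensity_nonneg n r x) h.eventuallyLE

lemma value_rankValuation_Icc {n r : ℕ} {x y : ℝ} (hx : 0 ≤ x) (hxy : x ≤ y) :
    (rankValuation n r).value (Set.Icc x y) =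
      (rankValuation n r).eval y - (rankValuation n r).eval x := by
  have hi : ∀ S, IntegrableOn (rankDensity n r) S := fun S =>
    (integrable_rankDensity n r).integrableOn
  have : Set.Icc 0 y = Set.Icc 0 x ∪ Set.Ioc x y := (Set.Icc_union_Ioc_eq_Icc hx hxy).symm
  change ∫ z in Set.Icc x y, rankDensity n r z =
    (∫ z in Set.Icc 0 y, rankDensity n r z) - ∫ z in Set.Icc 0 x, rankDensity n r z
  rw [this, setIntegral_union _ measurableSet_Ioc (hi _) (hi _), integral_Icc_eq_integral_Ioc]
  · ring
  · exact Set.disjoint_left.2 fun z hz hz' => absurd hz.2 (not_le.2 hz'.1)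

/-! ### A proportional allocation reveals the ranks -/

namespace ContiguousAllocation

variable {n : ℕ}

lemma piece_subset (A : ContiguousAllocation n) (i : Fin n) : A.piece i ⊆ Set.Icc 0 1 :=
  A.iUnion_eq ▸ Set.subset_iUnion A.piece i

lemma lt_of_mem_piece (A : ContiguousAllocation n) {i j : Fin n} {x y x' y' : ℝ}
    (hx : x ∈ A.piece i) (hy : y ∈ A.piece j) (hxy : x < y) (hij : i ≠ j)
    (hx' : x' ∈ A.piece i) (hy' : y' ∈ A.piece j) : x' < y' := by
  have hd := Set.disjoint_left.1 (A.disjoint i j hij)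
  by_contra! h
  rcases le_or_gt y x' with h1 | h1
  · exact hd ((A.ordConnected i).out hx hx' ⟨hxy.le, h1⟩) hy
  · exact hd hx' ((A.ordConnected j).out hy' hy ⟨h, h1.le⟩)

lemma Proportional.nonempty {A : ContiguousAllocation n} {V : Profile n}
    (h : A.Proportional V) (i : Fin n) : (A.piece i).Nonempty := by
  by_contra! h'
  have h1 := h i
  have : (0 : ℝ) < n := by exact_mod_cast i.pos
  rw [h'] at h1
  simp only [Valuation.value, Measure.restrict_empty, integral_zero_measure] at h1
  have : 0 < 1 / (n : ℝ) := by positivity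
  linarith

/-- In a proportional allocation each agent stands in the place given by her rank. -/
lemma Proportional.rank_eq {A : ContiguousAllocation n} {π σ : Equiv.Perm (Fin n)}
    (h : A.Proportional (rankProfile π)) {x : Fin n → ℝ} (hx : ∀ i, x i ∈ A.piece i)
    (hσ : StrictMono (x ∘ σ)) (i : Fin n) : π (σ i) = i := by
  have hn0 : 0 < n := i.pos
  have hn : (0 : ℝ) < n := by exact_mod_cast hn0
  -- This slack between a fair share and one region drives both inductions below.
  have hN : (1 : ℝ) / (n + 1) < 1 / n := by gcongr; linarith
  set y : Fin n → ℝ := fun j => sSup (A.piece (σ j)) with hy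
  have hbdd : ∀ j, BddAbove (A.piece j) := fun j => bddAbove_Icc.mono (A.piece_subset j)
  have hle : ∀ j, ∀ z ∈ A.piece (σ j), z ≤ y j := fun j z hz => le_csSup (hbdd _) hz
  have hy0 : ∀ j, 0 ≤ y j := fun j => ((A.piece_subset _) (hx (σ j))).1.trans (hle j _ (hx _))
  have hge : ∀ j k : Fin n, j < k → ∀ z ∈ A.piece (σ k), y j ≤ z := fun j k hjk z hz =>
    csSup_le ⟨_, hx _⟩ fun w hw => (A.lt_of_mem_piece (hx _) (hx _) (hσ hjk)
      (σ.injective.ne hjk.ne) hw hz).le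
  have hval : ∀ j, 1 / (n : ℝ) ≤ (rankValuation n (π (σ j))).eval (y j) := fun j =>
    (h (σ j)).trans (value_rankValuation_mono fun z hz =>
      ⟨(A.piece_subset _ hz).1, hle j z hz⟩)
  have hstep : ∀ j k : Fin n, j < k → (rankValuation n (π (σ k))).eval (y j) + 1 / (n : ℝ) ≤
      (rankValuation n (π (σ k))).eval (y k) := fun j k hjk => by
    have h1 := (h (σ k)).trans (value_rankValuation_mono (n := n) (r := π (σ k))
      (T := Set.Icc (y j) (y k)) fun z hz => ⟨hge j k hjk z hz, hle k z hz⟩)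
    rw [value_rankValuation_Icc (hy0 j) ((hge j k hjk _ (hx _)).trans (hle k _ (hx _)))] at h1
    linarith
  -- the lower bounds, from the left
  have hF : ∀ j : ℕ, ∀ hj : j < n, ((j : ℝ) + 1) / (n + 1) <
      (rankValuation n (π (σ ⟨j, hj⟩))).eval (y ⟨j, hj⟩) := by
    intro j
    induction j with
    | zero => intro hj; have := hval ⟨0, hj⟩; push_cast; rw [zero_add]; linarith
    | succ j ih =>
      intro hj
      have h1 := ih (by omega)
      have h2 : slotLeft n (j + 1) 0 < y ⟨j, by omega⟩ := by
        by_contra! h3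
        have := eval_rankValuation_mono n (π (σ ⟨j, by omega⟩)) h3
        rw [eval_rankValuation_slotLeft (by omega) _ (Nat.zero_le _)] at this
        push_cast at this
        linarith
      have h3 := eval_rankValuation_mono n (π (σ ⟨j + 1, hj⟩)) h2.le
      rw [eval_rankValuation_slotLeft (by omega) _ (Nat.zero_le _)] at h3
      have h4 := hstep ⟨j, by omega⟩ ⟨j + 1, hj⟩ (by simp)
      have h5 : (((j + 1 : ℕ) : ℝ) + 1) / (n + 1) = ((j + 1 : ℕ) : ℝ) / (n + 1) + 1 / (n + 1) :=
        add_div _ _ _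
      linarith
  -- the upper bounds, from the right
  have hB : ∀ m j : ℕ, ∀ hj : j + 1 < n, j + 1 + m + 1 = n →
      (rankValuation n (π (σ ⟨j + 1, hj⟩))).eval (y ⟨j, by omega⟩) <
        ((j : ℝ) + 2) / (n + 1) := by
    intro m
    induction m with
    | zero =>
      intro j hj hm
      have h4 := hstep ⟨j, by omega⟩ ⟨j + 1, hj⟩ (by simp)
      have h6 : (rankValuation n (π (σ ⟨j + 1, hj⟩))).eval (y ⟨j + 1, hj⟩) ≤ 1 := by
        rw [← eval_rankValuation_of_one_le (le_max_right (y ⟨j + 1, hj⟩) 1)]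
        exact eval_rankValuation_mono _ _ (le_max_left _ _)
      have h7 : (j : ℝ) + 2 = n := by rw [← hm]; push_cast; ring
      have h8 : (n : ℝ) / (n + 1) = 1 - 1 / (n + 1) := by field_simp; ring
      rw [h7, h8]
      linarith
    | succ m ih =>
      intro j hj hm
      have h1 := ih (j + 1) (by omega) (by omega)
      have e : ((j + 1 : ℕ) : ℝ) + 2 = ((j + 2 : ℕ) : ℝ) + 1 := by push_cast; ring
      have h2 : y ⟨j + 1, hj⟩ < slotLeft n (j + 2) 3 := by
        by_contra! h3
        have := eval_rankValuation_mono n (π (σ ⟨j + 1 + 1, by omega⟩)) h3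
        rw [eval_rankValuation_slotLeft' (by omega) _
          (by have := slot_le_two (j + 2) (π (σ ⟨j + 1 + 1, by omega⟩)); omega) le_rfl] at this
        rw [e] at h1
        linarith
      have h3 := eval_rankValuation_mono n (π (σ ⟨j + 1, hj⟩)) h2.le
      rw [eval_rankValuation_slotLeft' (by omega) _
        (by have := slot_le_two (j + 2) (π (σ ⟨j + 1, hj⟩)); omega) le_rfl] at h3
      have h4 := hstep ⟨j, by omega⟩ ⟨j + 1, hj⟩ (by simp)
      have h5 : (((j + 2 : ℕ) : ℝ) + 1) / (n + 1) = ((j : ℝ) + 2) / (n + 1) + 1 / (n + 1) := by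
        rw [← add_div]; push_cast; ring
      linarith
  -- By `hF` the boundary `y j` is past the start of the slot of agent `σ j` in region `j + 1`; by
  -- `hB` it is before the end of the slot of agent `σ (j + 1)` there.
  have hslot : ∀ j : ℕ, ∀ hj : j + 1 < n,
      slot (j + 1) (π (σ ⟨j, by omega⟩)) ≤ slot (j + 1) (π (σ ⟨j + 1, hj⟩)) := by
    intro j hj
    have h1 : slotLeft n (j + 1) (slot (j + 1) (π (σ ⟨j, by omega⟩))) < y ⟨j, by omega⟩ := by
      by_contra! h3
      have := eval_rankValuation_mono n (π (σ ⟨j, by omega⟩)) h3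
      rw [eval_rankValuation_slotLeft (by omega) _ le_rfl] at this
      have := hF j (by omega)
      push_cast at *
      linarith
    have h2 : y ⟨j, by omega⟩ < slotLeft n (j + 1) (slot (j + 1) (π (σ ⟨j + 1, hj⟩)) + 1) := by
      by_contra! h3
      have := eval_rankValuation_mono n (π (σ ⟨j + 1, by omega⟩)) h3
      rw [eval_rankValuation_slotLeft' (by omega) _ (Nat.lt_succ_self _)
        (by have := slot_le_two (j + 1) (π (σ ⟨j + 1, hj⟩)); omega)] at this
      have h4 := hB (n - (j + 2)) j hj (by omega)
      have e : ((j + 1 : ℕ) : ℝ) + 1 = j + 2 := by push_cast; ring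
      rw [e] at this
      linarith
    have := lt_of_slotLeft_lt (h1.trans h2)
    omega
  have hinj : ∀ j k (hj : j < n) (hk : k < n), j ≠ k →
      (π (σ ⟨j, hj⟩) : ℕ) ≠ π (σ ⟨k, hk⟩) := fun j k hj hk hjk h => hjk <| by
    simpa using σ.injective (π.injective (Fin.ext h))
  -- no rank exceeds its place
  have hupper : ∀ m j : ℕ, ∀ hj : j < n, j + m + 1 = n → (π (σ ⟨j, hj⟩) : ℕ) ≤ j := by
    intro m
    induction m with
    | zero => intro j hj hm; have := (π (σ ⟨j, hj⟩)).2; omega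
    | succ m ih =>
      intro j hj hm
      have h1 := ih (j + 1) (by omega) (by omega)
      have h2 := hslot j (by omega)
      have h3 := hinj j (j + 1) hj (by omega) (by omega)
      -- The rank at place `j + 1` is at most `j + 1`, so its slot is at most `1`; a rank above `j`
      -- at place `j` would then make both ranks equal to `j + 1`.
      unfold slot at h2
      omega
  have hle' : ∀ j, π (σ j) ≤ j := fun j => hupper (n - (j + 1)) j j.2 (by omega)
  have hsum : ∑ j, ((π (σ j) : Fin n) : ℕ) = ∑ j : Fin n, (j : ℕ) :=
    Equiv.sum_comp (σ.trans π) fun j : Fin n => (j : ℕ)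
  exact Fin.ext ((Finset.sum_eq_sum_iff_of_le fun j _ => Fin.le_def.1 (hle' j)).1 hsum i
    (Finset.mem_univ i))

/-- The left-to-right order of the pieces depends on `A` alone, and it is the inverse of the rank
permutation. -/
lemma Proportional.perm_eq {A : ContiguousAllocation n} {π π' : Equiv.Perm (Fin n)}
    (h : A.Proportional (rankProfile π)) (h' : A.Proportional (rankProfile π')) : π = π' := by
  choose x hx using h.nonempty
  have hinj : Function.Injective x := fun i j hij => by
    by_contra hne
    exact Set.disjoint_left.1 (A.disjoint i j hne) (hx i) (hij ▸ hx j)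
  have hσ : StrictMono (x ∘ Tuple.sort x) :=
    (Tuple.monotone_sort x).strictMono_of_injective (hinj.comp (Tuple.sort x).injective)
  ext i
  obtain ⟨j, rfl⟩ := (Tuple.sort x).surjective i
  rw [h.rank_eq hx hσ, h'.rank_eq hx hσ]

end ContiguousAllocation

/-! ### Counting the answer lists of one batch -/

variable {n : ℕ}

/-- The region on which the answer to a query depends. -/
noncomputable def Query.region (q : Query n) : ℕ := q.exists_region.choose

lemma Query.answer_eq (q : Query n) {π π' : Equiv.Perm (Fin n)}
    (h : slot q.region (π q.agent) = slot q.region (π' q.agent)) :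
    q.answer (rankProfile π) = q.answer (rankProfile π') :=
  q.exists_region.choose_spec π π' h

/-- The sum of the slots that the queries to agent `i` ask for; it determines these slots. -/
noncomputable def signature (qs : List (Query n)) (π : Equiv.Perm (Fin n)) (i : Fin n) : ℕ :=
  (qs.map fun q => if q.agent = i then slot q.region (π i) else 0).sum

lemma signature_le (qs : List (Query n)) (π : Equiv.Perm (Fin n)) (i : Fin n) :
    signature qs π i ≤ 2 * qs.countP (fun q => q.agent = i) := by
  induction qs with
  | nil => simp [signature]
  | cons q qs ih =>
    have := slot_le_two q.region (π i)
    unfold signature at *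
    by_cases h : q.agent = i <;> simp [h] at ih ⊢ <;> omega

lemma List.forall_eq_of_sum_map_eq {α : Type*} {l : List α} {f g : α → ℕ}
    (h : ∀ a ∈ l, f a ≤ g a) (hs : (l.map f).sum = (l.map g).sum) : ∀ a ∈ l, f a = g a := by
  induction l with
  | nil => simp
  | cons a l ih =>
    simp only [List.map_cons, List.sum_cons, List.forall_mem_cons] at *
    have := List.sum_le_sum h.2
    exact ⟨by omega, ih h.2 (by omega)⟩

/-- Of two ranks of an agent, the larger has the larger slot in every region, so equal sums force
equality term by term. -/
lemma answers_eq_of_signature_eq {qs : List (Query n)} {π π' : Equiv.Perm (Fin n)}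
    (h : signature qs π = signature qs π') :
    qs.map (Query.answer (rankProfile π)) = qs.map (Query.answer (rankProfile π')) := by
  refine List.map_congr_left fun q hq => q.answer_eq ?_
  have hs := congrFun h q.agent
  unfold signature at hs
  rcases le_total (π q.agent : ℕ) (π' q.agent) with hle | hle
  · have := List.forall_eq_of_sum_map_eq
      (fun a _ => by split_ifs <;> [exact slot_mono _ hle; exact le_rfl]) hs q hq
    simpa using this
  · have := List.forall_eq_of_sum_map_eq
      (fun a _ => by split_ifs <;> [exact slot_mono _ hle; exact le_rfl]) hs.symm q hq
    simpa using this.symm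

lemma sum_countP_agent (qs : List (Query n)) :
    ∑ i, qs.countP (fun q => q.agent = i) = qs.length := by
  induction qs with
  | nil => simp
  | cons q qs ih => simp [List.countP_cons, Finset.sum_add_distrib, ih]

lemma card_image_answers_le (qs : List (Query n)) (S : Finset (Equiv.Perm (Fin n))) :
    (S.image fun π => qs.map (Query.answer (rankProfile π))).card ≤
      ∏ i, (2 * qs.countP (fun q => q.agent = i) + 1) := by
  classical
  calc _ ≤ (S.image (signature qs)).card := by
        refine Finset.card_le_card_of_surjOn
          (fun s => qs.map (Query.answer (rankProfile
            (Function.invFunOn (signature qs) (S : Set (Equiv.Perm (Fin n))) s)))) ?_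
        intro a ha
        obtain ⟨π, hπ, rfl⟩ := Finset.mem_image.1 (Finset.mem_coe.1 ha)
        refine ⟨signature qs π, Finset.mem_coe.2 (Finset.mem_image_of_mem _ hπ), ?_⟩
        exact answers_eq_of_signature_eq (Function.invFunOn_eq ⟨π, hπ, rfl⟩)
    _ ≤ (Fintype.piFinset fun i =>
          Finset.range (2 * qs.countP (fun q => q.agent = i) + 1)).card := by
        refine Finset.card_le_card fun s hs => ?_
        obtain ⟨π, -, rfl⟩ := Finset.mem_image.1 hs
        simpa [Nat.lt_succ_iff] using signature_le qs π
    _ = _ := by simp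

/-- A tangent bound, tight at `x = t`. It turns the product over agents into an exponential of the
total number of queries, which adds up over rounds. -/
lemma le_mul_exp_div_sub_one {t : ℝ} (ht : 0 < t) (x : ℝ) : x ≤ t * Real.exp (x / t - 1) := by
  have := Real.add_one_le_exp (x / t - 1)
  have h : x = t * (x / t) := by field_simp
  calc x = t * (x / t) := h
    _ ≤ _ := by gcongr; linarith

lemma card_image_answers_le_exp (qs : List (Query n)) (S : Finset (Equiv.Perm (Fin n)))
    {t : ℝ} (ht : 0 < t) :
    ((S.image fun π => qs.map (Query.answer (rankProfile π))).card : ℝ) ≤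
      (t * Real.exp (1 / t - 1)) ^ n * Real.exp (2 * qs.length / t) := by
  have hc : ((S.image fun π => qs.map (Query.answer (rankProfile π))).card : ℝ) ≤
      ∏ i, ((2 * qs.countP (fun q => q.agent = i) + 1 : ℕ) : ℝ) := by
    exact_mod_cast card_image_answers_le qs S
  refine hc.trans ((Finset.prod_le_prod (fun i _ => by positivity)
    fun i _ => le_mul_exp_div_sub_one ht _).trans_eq ?_)
  rw [Finset.prod_mul_distrib, Finset.prod_const, ← Real.exp_sum, mul_pow, mul_assoc,
    ← Real.exp_nat_mul, ← Real.exp_add, Finset.card_univ, Fintype.card_fin, ← sum_countP_agent qs]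
  congr 2
  push_cast
  simp only [add_div, Finset.sum_sub_distrib, Finset.sum_add_distrib, Finset.sum_const,
    Finset.card_univ, Fintype.card_fin, nsmul_eq_mul, Finset.mul_sum, Finset.sum_div]
  ring

/-! ### The Kraft inequality over all rounds -/

/-- A Kraft inequality: the instances on which a protocol succeeds are separated by the answers it
receives. -/
lemma Protocol.sum_exp_neg_numQueries_le {k : ℕ} (P : Protocol n k)
    (S : Finset (Equiv.Perm (Fin n)))
    (hS : ∀ π ∈ S, (P.output (rankProfile π)).Proportional (rankProfile π)) {t : ℝ} (ht : 0 < t) :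
    ∑ π ∈ S, Real.exp (-(2 * P.numQueries (rankProfile π) / t)) ≤
      ((t * Real.exp (1 / t - 1)) ^ n) ^ k := by
  classical
  induction P generalizing S with
  | done A =>
    have hcard : S.card ≤ 1 :=
      Finset.card_le_one.2 fun π hπ π' hπ' => (hS π hπ).perm_eq (hS π' hπ')
    simpa [numQueries] using hcard
  | @round k qs next ih =>
    set ans := fun π : Equiv.Perm (Fin n) => qs.map (Query.answer (rankProfile π)) with hans
    set B := (t * Real.exp (1 / t - 1)) ^ n with hB
    have hB0 : 0 ≤ B := by positivity
    have h1 : ∀ a ∈ S.image ans, ∑ π ∈ S with ans π = a,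
        Real.exp (-(2 * (round qs next).numQueries (rankProfile π) / t)) ≤
          Real.exp (-(2 * qs.length / t)) * B ^ k := by
      intro a _
      have h2 := ih a (S.filter fun π => ans π = a) fun π hπ => by
        exact (Finset.mem_filter.1 hπ).2 ▸ hS π (Finset.mem_filter.1 hπ).1
      refine le_trans (le_of_eq ?_) (mul_le_mul_of_nonneg_left h2 (Real.exp_nonneg _))
      rw [Finset.mul_sum]
      refine Finset.sum_congr rfl fun π hπ => ?_
      obtain ⟨-, rfl⟩ := Finset.mem_filter.1 hπ
      rw [← Real.exp_add, numQueries]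
      push_cast
      congr 1
      ring
    rw [← Finset.sum_fiberwise_of_maps_to (g := ans) (t := S.image ans)
      fun π hπ => Finset.mem_image_of_mem _ hπ]
    refine (Finset.sum_le_sum h1).trans ?_
    rw [Finset.sum_const, nsmul_eq_mul]
    -- The exponential in the number of answer lists cancels the weight of this round's queries.
    calc _ ≤ (B * Real.exp (2 * qs.length / t)) * (Real.exp (-(2 * qs.length / t)) * B ^ k) := by
          gcongr; exact card_image_answers_le_exp qs S ht
      _ = B ^ (k + 1) := by
          rw [Real.exp_neg]; field_simp; ring

-- Each counted permutation has Kraft weight at least `exp (-(k n (t - 1) / t))`; the budget is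
-- chosen so that this cancels the factor `exp (1/t - 1) ^ (k n)`.
open Classical in
lemma Protocol.card_success_le {k : ℕ} (P : Protocol n k) {t : ℝ} (ht : 0 < t) :
    ((Finset.univ.filter fun π : Equiv.Perm (Fin n) =>
      (P.output (rankProfile π)).Proportional (rankProfile π) ∧
        (P.numQueries (rankProfile π) : ℝ) ≤ k * n * (t - 1) / 2).card : ℝ) ≤ t ^ (k * n) := by
  set S := Finset.univ.filter fun π : Equiv.Perm (Fin n) =>
      (P.output (rankProfile π)).Proportional (rankProfile π) ∧
        (P.numQueries (rankProfile π) : ℝ) ≤ k * n * (t - 1) / 2 with hSdef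
  have h1 := P.sum_exp_neg_numQueries_le S (fun π hπ => (Finset.mem_filter.1 hπ).2.1) ht
  have h2 : S.card • Real.exp (-(k * n * (t - 1) / t)) ≤
      ∑ π ∈ S, Real.exp (-(2 * P.numQueries (rankProfile π) / t)) := by
    refine Finset.card_nsmul_le_sum _ _ _ fun π hπ => ?_
    have := (Finset.mem_filter.1 hπ).2.2
    exact Real.exp_le_exp.2 (neg_le_neg (div_le_div_of_nonneg_right (by linarith) ht.le))
  rw [nsmul_eq_mul] at h2
  have h3 := h2.trans h1
  rw [← pow_mul, mul_pow, ← Real.exp_nat_mul, Real.exp_neg] at h3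
  rw [← div_eq_mul_inv, div_le_iff₀ (Real.exp_pos _), mul_assoc, ← Real.exp_add] at h3
  have h4 : ((n * k : ℕ) : ℝ) * (1 / t - 1) + k * n * (t - 1) / t = 0 := by
    push_cast; field_simp; ring
  rwa [h4, Real.exp_zero, mul_one, mul_comm n k] at h3

/-! ### Success requires a query -/

variable {k : ℕ}

lemma Protocol.Legal.demarcatedBy_of_numQueries_eq_zero {V : Profile n} {P : Protocol n k}
    {C : Set ℝ} (h : P.Legal V C) (h0 : P.numQueries V = 0) : (P.output V).DemarcatedBy C := by
  induction P generalizing C with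
  | done A => exact h
  | round qs next ih =>
    have h1 : qs = [] := by
      rw [numQueries] at h0
      exact List.eq_nil_of_length_eq_zero (by omega)
    subst h1
    have h2 := ih _ h.2 (Nat.eq_zero_of_add_eq_zero_left h0)
    simpa [cutPoints, output] using h2

lemma subset_of_frontier_disjoint {s t : Set ℝ} (hs : IsPreconnected s)
    (hst : (s ∩ t).Nonempty) (h : Disjoint s (frontier t)) : s ⊆ t := by
  by_contra hn
  obtain ⟨x, hx, hxt⟩ := Set.not_subset.1 hn
  have hcover : s ⊆ interior t ∪ (closure t)ᶜ := fun z hz => by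
    by_cases h1 : z ∈ closure t
    · left
      by_contra h2
      exact Set.disjoint_left.1 h hz ⟨h1, h2⟩
    · exact Or.inr h1
  obtain ⟨z, hz, hzt⟩ := hst
  obtain ⟨w, -, h1, h2⟩ := hs _ _ isOpen_interior isClosed_closure.isOpen_compl hcover
    ⟨z, hz, (hcover hz).resolve_right fun h' => h' (subset_closure hzt)⟩
    ⟨x, hx, (hcover hx).resolve_left fun h' => hxt (interior_subset h')⟩
  exact h2 (subset_closure (interior_subset h1))

/-- A piece without endpoints in `(0,1)` either contains all of `(0,1)` or is null. A proportional
allocation has no null piece, and two disjoint pieces cannot both contain `(0,1)`. -/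
lemma ContiguousAllocation.DemarcatedBy.not_proportional {A : ContiguousAllocation n}
    (hA : A.DemarcatedBy {0, 1}) (hn : 2 ≤ n) (V : Profile n) : ¬ A.Proportional V := by
  intro h
  have hn0 : (0 : ℝ) < n := by exact_mod_cast (by omega : 0 < n)
  have key : ∀ i, Set.Ioo 0 1 ⊆ A.piece i := fun i => by
    refine subset_of_frontier_disjoint isPreconnected_Ioo ?_ ?_
    · by_contra hne
      have hsub : A.piece i ⊆ {0, 1} := fun z hz => by
        have h1 := A.piece_subset i hz
        by_contra hz'
        simp only [Set.mem_insert_iff, Set.mem_singleton_iff, not_or] at hz'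
        exact hne ⟨z, ⟨lt_of_le_of_ne h1.1 (Ne.symm hz'.1), lt_of_le_of_ne h1.2 hz'.2⟩, hz⟩
      have hnull : volume (A.piece i) = 0 :=
        measure_mono_null hsub ((Set.toFinite _).measure_zero _)
      have h1 := h i
      rw [Valuation.value, setIntegral_measure_zero _ hnull] at h1
      have : 0 < 1 / (n : ℝ) := by positivity
      linarith
    · refine Set.disjoint_left.2 fun z hz hz' => ?_
      rcases hA i hz' with rfl | rfl
      · exact lt_irrefl _ hz.1
      · exact lt_irrefl _ hz.2
  have hmem : (1 / 2 : ℝ) ∈ Set.Ioo (0 : ℝ) 1 := by norm_num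
  exact Set.disjoint_left.1 (A.disjoint ⟨0, by omega⟩ ⟨1, by omega⟩ (by simp)) (key _ hmem)
    (key _ hmem)

/-! ### Averaging over the random seed -/

variable {Ω : Type*} [MeasurableSpace Ω] {μ : Measure Ω}

/-- A successful execution issues at least one query. -/
lemma RandomizedAlgorithm.successProb_le_expectedQueries (𝒜 : RandomizedAlgorithm n k Ω)
    (hn : 2 ≤ n) (V : Profile n) : 𝒜.successProb μ V ≤ 𝒜.expectedQueries μ V := by
  rw [successProb, expectedQueries, ← lintegral_indicator_one (𝒜.measurableSet_proportional V)]
  refine lintegral_mono (Set.indicator_le fun ω h => ?_)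
  have : 1 ≤ (𝒜.protocol ω).numQueries V := by
    by_contra! h0
    exact ((𝒜.legal ω V).demarcatedBy_of_numQueries_eq_zero (by omega)).not_proportional hn V h
  simpa using this

/-- If every deterministic protocol succeeds with at most `q` queries on few of the instances
`rankProfile π`, then some instance requires more than `q` queries with constant probability. -/
lemma RandomizedAlgorithm.exists_le_expectedQueries [IsProbabilityMeasure μ]
    (𝒜 : RandomizedAlgorithm n k Ω) {p t : ℝ} (hp : 0 ≤ p)
    (hsucc : ∀ V : Profile n, ENNReal.ofReal p ≤ 𝒜.successProb μ V) (ht : 0 < t)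
    (htn : t ^ (k * n) ≤ p / 2 * n.factorial) :
    ∃ V : Profile n, ENNReal.ofReal (p / 2 * (k * n * (t - 1) / 2)) ≤ 𝒜.expectedQueries μ V := by
  classical
  set q : ℝ := k * n * (t - 1) / 2 with hq
  rcases lt_or_ge q 0 with hq0 | hq0
  · exact ⟨rankProfile 1, by rw [ENNReal.ofReal_of_nonpos (by nlinarith)]; exact zero_le⟩
  -- `E` is cheap success and `H` an expensive execution; every success lies in one of them.
  let E : Equiv.Perm (Fin n) → Set Ω := fun π =>
    {ω | ((𝒜.protocol ω).output (rankProfile π)).Proportional (rankProfile π)} ∩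
      {ω | ((𝒜.protocol ω).numQueries (rankProfile π) : ℝ) ≤ q}
  let H : Equiv.Perm (Fin n) → Set Ω := fun π =>
    {ω | ENNReal.ofReal q ≤ ((𝒜.protocol ω).numQueries (rankProfile π) : ENNReal)}
  have hmeas : ∀ π, MeasurableSet (E π) := fun π =>
    (𝒜.measurableSet_proportional _).inter (measurableSet_le
      (measurable_from_nat.comp (𝒜.measurable_numQueries (rankProfile π))) measurable_const)
  have hE : ∑ π, μ (E π) ≤ ENNReal.ofReal (p / 2) * n.factorial := by
    calc ∑ π, μ (E π) = ∫⁻ ω, ∑ π, (E π).indicator 1 ω ∂μ := by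
          rw [lintegral_finsetSum _ fun π _ => measurable_one.indicator (hmeas π)]
          simp_rw [lintegral_indicator_one (hmeas _)]
      _ ≤ ∫⁻ _, ENNReal.ofReal (p / 2) * n.factorial ∂μ := by
          refine lintegral_mono fun ω => ?_
          have h1 := (𝒜.protocol ω).card_success_le ht
          have h2 : ∑ π, (E π).indicator (1 : Ω → ENNReal) ω =
              ((Finset.univ.filter fun π => ω ∈ E π).card : ENNReal) := by
            rw [Finset.card_filter, Nat.cast_sum]
            refine Finset.sum_congr rfl fun π _ => ?_
            by_cases h : ω ∈ E π <;> simp [h]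
          rw [h2, ← ENNReal.ofReal_natCast n.factorial, ← ENNReal.ofReal_mul (by positivity),
            ← ENNReal.ofReal_natCast]
          exact ENNReal.ofReal_le_ofReal (h1.trans htn)
      _ = _ := by simp
  have hsplit : ∀ π, ENNReal.ofReal p ≤ μ (E π) + μ (H π) := fun π => by
    refine (hsucc (rankProfile π)).trans ((measure_mono fun ω hω => ?_).trans
      (measure_union_le _ _))
    rcases le_total ((𝒜.protocol ω).numQueries (rankProfile π) : ℝ) q with h | h
    · exact Or.inl ⟨hω, h⟩
    · refine Or.inr ?_
      change ENNReal.ofReal q ≤ _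
      rw [← ENNReal.ofReal_natCast]
      exact ENNReal.ofReal_le_ofReal h
  have hcard : (Finset.univ : Finset (Equiv.Perm (Fin n))).card = n.factorial := by
    rw [Finset.card_univ, Fintype.card_perm, Fintype.card_fin]
  have hsum : ∑ _π : Equiv.Perm (Fin n), ENNReal.ofReal (p / 2) ≤ ∑ π, μ (H π) := by
    have h1 : ENNReal.ofReal (p / 2) * n.factorial + ENNReal.ofReal (p / 2) * n.factorial ≤
        ENNReal.ofReal (p / 2) * n.factorial + ∑ π, μ (H π) := by
      calc _ = ∑ _π : Equiv.Perm (Fin n), ENNReal.ofReal p := by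
            rw [Finset.sum_const, hcard, nsmul_eq_mul, ← add_mul,
              ← ENNReal.ofReal_add (by positivity) (by positivity), add_halves, mul_comm]
        _ ≤ ∑ π, (μ (E π) + μ (H π)) := Finset.sum_le_sum fun π _ => hsplit π
        _ ≤ _ := by rw [Finset.sum_add_distrib]; gcongr
    rw [Finset.sum_const, hcard, nsmul_eq_mul, mul_comm]
    exact (ENNReal.add_le_add_iff_left
      (ENNReal.mul_ne_top ENNReal.ofReal_ne_top (ENNReal.natCast_ne_top _))).1 h1
  obtain ⟨π, -, hπ⟩ := ENNReal.exists_le_of_sum_le ⟨1, Finset.mem_univ _⟩ hsum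
  refine ⟨rankProfile π, ?_⟩
  -- Markov's inequality on `H π`.
  rw [mul_comm, ENNReal.ofReal_mul hq0]
  exact le_trans (mul_le_mul_right hπ _) (mul_meas_ge_le_lintegral
    (measurable_from_nat.comp (𝒜.measurable_numQueries (rankProfile π))) (ENNReal.ofReal q))

/-! ### Choice of the parameter and of the constants -/

lemma div_exp_one_pow_le_factorial (n : ℕ) : ((n : ℝ) / Real.exp 1) ^ n ≤ n.factorial := by
  rcases Nat.eq_zero_or_pos n with rfl | hn
  · simp
  refine le_trans ?_ (Stirling.le_factorial_stirling n)
  have h1 : (1 : ℝ) ≤ n := by exact_mod_cast hn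
  have : 1 ≤ √(2 * Real.pi * n) := by
    rw [Real.one_le_sqrt]
    nlinarith [Real.pi_gt_three]
  exact le_mul_of_one_le_left (by positivity) this

/-- The constant of the lower bound for many agents. -/
lemma exists_round_base {p C : ℝ} (hp : 0 < p) (hp1 : p ≤ 1) (hC : 0 < C) :
    ∃ a : ℝ, 0 < a ∧ ∃ N : ℝ, ∀ n k : ℕ, 2 ≤ n → 1 ≤ k → (k : ℝ) ≤ C * Real.logb 2 n → N ≤ n →
      ∃ t : ℝ, 0 < t ∧ t ^ (k * n) ≤ p / 2 * n.factorial ∧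
        a * (n : ℝ) ^ (1 / (k : ℝ)) ≤ t - 1 := by
  have he : 1 < Real.exp 1 := Real.one_lt_exp_iff.2 one_pos
  set b : ℝ := p / 2 / Real.exp 1 with hb
  have hb0 : 0 < b := by positivity
  have hb1 : b ≤ 1 := by
    rw [hb, div_le_one (by positivity)]; linarith
  set η : ℝ := Real.log 2 / (2 * C) with hη
  have hl2 : 0 < Real.log 2 := Real.log_pos one_lt_two
  have hη0 : 0 < η := by positivity
  refine ⟨b * (1 - Real.exp (-η)), ?_, 1 / b ^ 2, ?_⟩
  · have : Real.exp (-η) < 1 := by rw [Real.exp_lt_one_iff]; linarith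
    exact mul_pos hb0 (by linarith)
  intro n k hn hk hkC hN
  have hk0 : (0 : ℝ) < k := by exact_mod_cast hk
  have hn0 : (0 : ℝ) < n := by positivity
  have hn1 : (1 : ℝ) < n := by exact_mod_cast hn
  -- With this `t`, `t ^ (k n) = (p/2)^n (n/e)^n`, and `(n/e)^n ≤ n!`.
  refine ⟨(b * n) ^ (1 / (k : ℝ)), by positivity, ?_, ?_⟩
  · rw [pow_mul, one_div, Real.rpow_inv_natCast_pow (by positivity) (by omega)]
    have h1 : b * n = p / 2 * (n / Real.exp 1) := by rw [hb]; ring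
    rw [h1, mul_pow]
    gcongr
    · exact pow_le_of_le_one (by positivity) (by linarith) (by omega)
    · exact div_exp_one_pow_le_factorial n
  -- From `n ≥ 1/b²` and `k ≤ C log₂ n` one gets `t ≥ exp η`, so subtracting `1` from `t` costs at
  -- most the factor `1 - exp (-η)`.
  · have hlog : Real.log n / 2 ≤ Real.log (b * n) := by
      have h1 := Real.log_le_log (by positivity) hN
      rw [one_div, Real.log_inv, Real.log_pow] at h1
      rw [Real.log_mul hb0.ne' hn0.ne']
      push_cast at h1
      linarith
    have hln : 0 < Real.log n := Real.log_pos hn1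
    have h1 : η ≤ Real.log (b * n) * (1 / k) := by
      rw [mul_one_div, le_div_iff₀ hk0]
      calc η * k ≤ η * (C * Real.logb 2 n) := by gcongr
        _ = Real.log n / 2 := by rw [hη, Real.logb]; field_simp
        _ ≤ _ := hlog
    have h2 : Real.exp η ≤ (b * n) ^ (1 / (k : ℝ)) := by
      rw [Real.rpow_def_of_pos (by positivity)]
      exact Real.exp_le_exp.2 h1
    have h3 : b ≤ b ^ (1 / (k : ℝ)) := by
      refine (Real.rpow_one b).symm.trans_le (Real.rpow_le_rpow_of_exponent_ge hb0 hb1 ?_)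
      rw [div_le_one hk0]; exact_mod_cast hk
    have h4 : 1 ≤ Real.exp (-η) * (b * n) ^ (1 / (k : ℝ)) := by
      calc (1 : ℝ) = Real.exp (-η) * Real.exp η := by rw [← Real.exp_add]; simp
        _ ≤ _ := by gcongr
    have h5 : Real.exp (-η) ≤ 1 := by rw [Real.exp_le_one_iff]; linarith
    calc b * (1 - Real.exp (-η)) * (n : ℝ) ^ (1 / (k : ℝ))
        = (1 - Real.exp (-η)) * (b * (n : ℝ) ^ (1 / (k : ℝ))) := by ring
      _ ≤ (1 - Real.exp (-η)) * (b ^ (1 / (k : ℝ)) * (n : ℝ) ^ (1 / (k : ℝ))) := by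
          have : 0 ≤ 1 - Real.exp (-η) := by linarith
          gcongr
      _ = (1 - Real.exp (-η)) * (b * n) ^ (1 / (k : ℝ)) := by
          rw [Real.mul_rpow hb0.le hn0.le]
      _ ≤ _ := by linarith

end CakeCutting

theorem mainTheorem9 (p : ℝ) (hp : 0 < p) (C : ℝ) (hC : 0 < C) :
    ∃ c : ℝ, 0 < c ∧
      ∀ (n k : ℕ), 2 ≤ n → 1 ≤ k → (k : ℝ) ≤ C * Real.logb 2 (n : ℝ) →
        ∀ (Ω : Type*) [MeasurableSpace Ω] (μ : Measure Ω) [IsProbabilityMeasure μ]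
          (𝒜 : CakeCutting.RandomizedAlgorithm n k Ω),
          (∀ V : CakeCutting.Profile n, ENNReal.ofReal p ≤ 𝒜.successProb μ V) →
          ∃ V : CakeCutting.Profile n,
            ENNReal.ofReal (c * ((k : ℝ) * (n : ℝ) ^ (1 + 1 / (k : ℝ)))) ≤
              𝒜.expectedQueries μ V := by
  set p' := min p 1 with hp'
  have hp0 : 0 < p' := lt_min hp one_pos
  obtain ⟨a, ha, N, hN⟩ := CakeCutting.exists_round_base hp0 (min_le_right p 1) hC
  set M := max N 1 with hM
  have hM1 : 1 ≤ M := le_max_right _ _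
  refine ⟨min (p' / 4 * a) (p' / (C * M ^ 3)), by positivity, ?_⟩
  intro n k hn hk hkC Ω _ μ _ 𝒜 hsucc
  have hn0 : (0 : ℝ) < n := by positivity
  have hn1 : (1 : ℝ) ≤ n := by exact_mod_cast (by omega : 1 ≤ n)
  have hk0 : (0 : ℝ) < k := by exact_mod_cast hk
  have hsucc' : ∀ V : CakeCutting.Profile n, ENNReal.ofReal p' ≤ 𝒜.successProb μ V := fun V =>
    (ENNReal.ofReal_le_ofReal (min_le_left p 1)).trans (hsucc V)
  rcases le_or_gt N n with hNn | hNn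
  · obtain ⟨t, ht, htn, hat⟩ := hN n k hn hk hkC hNn
    obtain ⟨V, hV⟩ := 𝒜.exists_le_expectedQueries hp0.le hsucc' ht htn
    refine ⟨V, (ENNReal.ofReal_le_ofReal ?_).trans hV⟩
    calc _ ≤ p' / 4 * a * ((k : ℝ) * (n : ℝ) ^ (1 + 1 / (k : ℝ))) := by
          gcongr; exact min_le_left _ _
      _ = p' / 4 * k * n * (a * (n : ℝ) ^ (1 / (k : ℝ))) := by
          rw [Real.rpow_add hn0, Real.rpow_one]; ring
      _ ≤ p' / 4 * k * n * (t - 1) := by gcongr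
      _ = _ := by ring
  -- For `n < N` both `k` and `n` are bounded in terms of `C` and `M`, and the second constant in
  -- the minimum brings the claimed bound below `p'`.
  · refine ⟨CakeCutting.rankProfile 1, (ENNReal.ofReal_le_ofReal ?_).trans
      ((hsucc' _).trans (𝒜.successProb_le_expectedQueries hn _))⟩
    have hnM : (n : ℝ) ≤ M := hNn.le.trans (le_max_left _ _)
    have h1 : (k : ℝ) ≤ C * M := by
      refine hkC.trans (mul_le_mul_of_nonneg_left (le_trans ?_ hnM) hC.le)
      rw [Real.logb_le_iff_le_rpow one_lt_two hn0, Real.rpow_natCast]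
      exact_mod_cast Nat.lt_two_pow_self.le
    have h2 : (n : ℝ) ^ (1 + 1 / (k : ℝ)) ≤ M ^ 2 := by
      calc (n : ℝ) ^ (1 + 1 / (k : ℝ)) ≤ (n : ℝ) ^ (2 : ℝ) := by
            refine Real.rpow_le_rpow_of_exponent_le hn1 ?_
            have : 1 / (k : ℝ) ≤ 1 := by rw [div_le_one hk0]; exact_mod_cast hk
            linarith
        _ = (n : ℝ) ^ 2 := Real.rpow_two _
        _ ≤ _ := by gcongr
    calc _ ≤ p' / (C * M ^ 3) * (C * M * M ^ 2) := by
          gcongr; exact min_le_right _ _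
      _ = p' := by field_simp
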